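/- All graphs are finite and simple. For a graph $G$, let $G^2$ be the graph obtained from $G$ by joining every pair of vertices at distance $2$ by a new edge. $G$ is subcubic if its maximum degree is at most $3$, and the girth of $G$ is the length of its shortest cycle ($\infty$ if $G$ has no cycle). Given a graph $F=(V,E)$ and a list assignment $L$ assigning to every $u\in V$ a finite set $L(u)$ of colors, a cover of $F$ for $L$ is a graph $H$ such that (1) $V(H)=\{(u,c):u\in V,\ c\in L(u)\}$; (2) for every $u\in V$ the set $\{u\}\times L(u)$ is a clique of $H$; (3) for every $uv\in E$ the edges of $H$ between $\{u\}\times L(u)$ and $\{v\}\times L(v)$ form a (possibly empty) matching; (4) for distinct $u,v$ with $uv\notin E$ there is no edge of $H$ between $\{u\}\times L(u)$ and $\{v\}\times L(v)$. The graph $F$ is DP-$k$-colorable if, for every $L$ with $|L(u)|\ge k$ for all $u\in V$, every cover of $F$ for $L$ has an independent set of size $|V|$. The DP-chromatic number $\chi_{DP}(F)$ is the least $k$ such that $F$ is DP-$k$-colorable. **Corollary.** If $G$ is a planar subcubic graph of girth $g>12$, then $\chi_{DP}(G^2)\le 6$. -/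

import Mathlib

namespace SimpleGraph

variable {V : Type*}

/-- The square `G²`: the graph obtained from `G` by joining any two vertices at distance `2`. -/
def square (G : SimpleGraph V) : SimpleGraph V where
  Adj u v := G.Adj u v ∨ G.dist u v = 2
  symm := ⟨fun u v h => by
    rcases h with h | h
    · exact Or.inl h.symm
    · exact Or.inr (by rw [dist_comm]; exact h)⟩
  loopless := ⟨fun v h => by
    rcases h with h | h
    · exact G.irrefl h
    · simp at h⟩

/-- A drawing of `G` in the Euclidean plane without crossings: vertices are distinct points, every
edge is a simple arc joining its two ends, and the relative interior of an arc contains no vertex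
and no point of another arc. -/
structure PlaneDrawing (G : SimpleGraph V) where
  /-- the point that represents a vertex -/
  point : V → EuclideanSpace ℝ (Fin 2)
  point_injective : Function.Injective point
  /-- the arc that represents an edge, with a parametrization -/
  arc : G.edgeSet → unitInterval → EuclideanSpace ℝ (Fin 2)
  arc_continuous : ∀ e, Continuous (arc e)
  arc_injective : ∀ e, Function.Injective (arc e)
  arc_ends : ∀ e : G.edgeSet, s(arc e 0, arc e 1) = Sym2.map point (e : Sym2 V)
  arc_ne_point : ∀ e, ∀ t ∈ Set.Ioo (0 : unitInterval) 1, ∀ v, arc e t ≠ point v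
  arc_ne_arc : ∀ e f, e ≠ f → ∀ s ∈ Set.Ioo (0 : unitInterval) 1, ∀ t, arc e s ≠ arc f t

/-- A graph is planar if it can be drawn in the plane without crossings. -/
def IsPlanar (G : SimpleGraph V) : Prop :=
  Nonempty G.PlaneDrawing

/-- `H` is a cover of `G` for the list assignment `L`. The vertices of `H` are the pairs `(u, c)`
with `c ∈ L u`. In `matching` it suffices to speak of one end of the matching edges, since `u` and
`v` may be exchanged. -/
structure IsCover (G : SimpleGraph V) {C : Type} (L : V → Finset C)
    (H : SimpleGraph (Σ u : V, {c : C // c ∈ L u})) : Prop where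
  clique : ∀ u, H.IsClique {x | x.1 = u}
  matching : ∀ u v, G.Adj u v → ∀ (a : {c : C // c ∈ L u}) (b b' : {c : C // c ∈ L v}),
    H.Adj ⟨u, a⟩ ⟨v, b⟩ → H.Adj ⟨u, a⟩ ⟨v, b'⟩ → b = b'
  not_adj : ∀ u v, u ≠ v → ¬ G.Adj u v →
    ∀ (a : {c : C // c ∈ L u}) (b : {c : C // c ∈ L v}), ¬ H.Adj ⟨u, a⟩ ⟨v, b⟩

/-- `G` is DP-`k`-colorable: for every assignment of lists of size at least `k`, every cover of `G`
has an independent set with exactly `|V|` elements. -/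
def IsDPColorable (G : SimpleGraph V) (k : ℕ) : Prop :=
  ∀ (C : Type) (L : V → Finset C), (∀ u, k ≤ (L u).card) →
    ∀ H : SimpleGraph (Σ u : V, {c : C // c ∈ L u}), G.IsCover L H →
      ∃ I : Finset (Σ u : V, {c : C // c ∈ L u}), H.IsIndepSet ↑I ∧ I.card = Nat.card V

/-- The DP-chromatic number: the least `k` such that `G` is DP-`k`-colorable (`⊤` if there is no
such `k`). -/
noncomputable def dpChromaticNumber (G : SimpleGraph V) : ℕ∞ :=
  ⨅ k ∈ {k : ℕ | G.IsDPColorable k}, (k : ℕ∞)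

end SimpleGraph

/-!
The proof combines a sparsity bound for planar graphs with greedy coloring.

Let `G` be planar and subcubic with girth at least `13`. All induced subgraphs inherit these
properties and satisfy `11 |E| ≤ 13 |V|`, by `IsPlanar.mul_card_edgeSet_le`. A count of the edges
between vertices of degrees `2` and `3` then shows that every nonempty induced subgraph has a vertex
of degree at most `1` or two adjacent vertices of degree at most `2`
(`exists_degree_le_one_or_adj_degree_le_two`). Such vertices have at most `5` neighbours in the
square, and their removal leaves the square of the rest intact. In a cover every colored neighbour
forbids at most one color, so a coloring of the rest extends (`IsCover.exists_partial_coloring`).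

The sparsity bound has to be derived from a drawing by arbitrary continuous arcs. Instead of the
topological faces of the drawing, the proof uses a fine square grid. The grid cells that meet a
small disk around a vertex, or the middle part of an arc, form connected sets
(`PlaneGrid.isLinked_cells`), and disjoint compact sets meet disjoint sets of cells once the grid is
fine enough. So `G` is a minor of the grid. Over `𝔽₂` every cycle of the grid is the boundary of a
set of unit squares (`PlaneGrid.boundary_eq_zero_iff`). This property passes to minors by merging
squares across deleted edges: the cycle space of `G` is spanned by cycles such that every edge lies
on at most two of them (`mul_card_edgeSet_le_of_branchSets`), as in Mac Lane's planarity criterion.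
At least `|E| - |V|` of these are nonzero, and each of the nonzero ones has at least as many edges
as the girth; double counting gives the bound (`mul_card_edgeSet_le_of_faces`).
-/

/-! ### Cycle spaces over the field with two elements -/

namespace SimpleGraph

/-- The boundary map `C₁ → C₀` over `𝔽₂` of the multigraph with vertex set `X` and edge set `E` in
which the edge `e` has the ends `s e` and `t e`. Over `𝔽₂` the order of the two ends is irrelevant;
the kernel of the map is the cycle space. -/
noncomputable def boundary {E X : Type*} (s t : E → X) :
    (E →₀ ZMod 2) →ₗ[ZMod 2] (X →₀ ZMod 2) :=
  Finsupp.linearCombination (ZMod 2) fun e => Finsupp.single (s e) 1 + Finsupp.single (t e) 1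

@[simp] lemma boundary_single {E X : Type*} (s t : E → X) (e : E) (a : ZMod 2) :
    boundary s t (Finsupp.single e a) = Finsupp.single (s e) a + Finsupp.single (t e) a := by
  simp [boundary]

/-- The coboundary identity: evaluating a vertex function on `boundary s t z` amounts to evaluating
on `z` the edge function that adds up the values at both ends. -/
lemma linearCombination_boundary {E X M : Type*} [AddCommGroup M] [Module (ZMod 2) M]
    (s t : E → X) (χ : X → M) (z : E →₀ ZMod 2) :
    Finsupp.linearCombination (ZMod 2) χ (boundary s t z) =
      Finsupp.linearCombination (ZMod 2) (fun e => χ (s e) + χ (t e)) z := by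
  rw [boundary, ← LinearMap.comp_apply]
  congr 1
  ext e
  simp

variable {V : Type*}

lemma ne_of_forall_edge_eq {G : SimpleGraph V} {s t : G.edgeSet → V}
    (hst : ∀ e : G.edgeSet, (e : Sym2 V) = s(s e, t e)) (e : G.edgeSet) : s e ≠ t e := fun h => by
  have := e.2
  rw [hst e, h] at this
  exact G.irrefl this

/-- The support of a nonzero element of the cycle space contains a cycle: otherwise any edge of the
support is a bridge of it, and summing the boundary over one side of the bridge leaves exactly the
coefficient of that edge. -/
theorem egirth_le_card_support {G : SimpleGraph V} {s t : G.edgeSet → V}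
    (hst : ∀ e : G.edgeSet, (e : Sym2 V) = s(s e, t e)) {z : G.edgeSet →₀ ZMod 2} (hz : z ≠ 0)
    (hb : boundary s t z = 0) : G.egirth ≤ z.support.card := by
  classical
  set H : SimpleGraph V :=
    fromEdgeSet {x | ∃ e : G.edgeSet, e ∈ z.support ∧ (e : Sym2 V) = x} with hH
  have hne := ne_of_forall_edge_eq hst
  have hHadj : ∀ e ∈ z.support, H.Adj (s e) (t e) := fun e he => by
    rw [hH, fromEdgeSet_adj]
    exact ⟨⟨e, he, hst e⟩, hne e⟩
  by_cases hac : H.IsAcyclic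
  · exfalso
    obtain ⟨e, he⟩ := Finsupp.support_nonempty_iff.mpr hz
    have hbr := isAcyclic_iff_forall_adj_isBridge.mp hac (hHadj e he)
    rw [isBridge_iff] at hbr
    set H' := H.deleteEdges {s(s e, t e)} with hH'
    have key := linearCombination_boundary s t
      (fun v => if H'.Reachable (s e) v then (1 : ZMod 2) else 0) z
    rw [hb, map_zero, Finsupp.linearCombination_apply, Finsupp.sum,
      Finset.sum_eq_single_of_mem e he] at key
    · rw [if_pos (Reachable.refl _), if_neg (by simpa using hbr)] at key
      rw [Finsupp.mem_support_iff] at he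
      simp at key
      exact he key.symm
    · intro f hf hfe
      have hadj : H'.Adj (s f) (t f) := by
        rw [hH', deleteEdges_adj]
        refine ⟨hHadj f hf, fun h => hfe (Subtype.ext ?_)⟩
        rw [hst f, hst e]
        exact h
      have : H'.Reachable (s e) (s f) ↔ H'.Reachable (s e) (t f) :=
        ⟨fun h => h.trans hadj.reachable, fun h => h.trans hadj.symm.reachable⟩
      simp only [this]
      rw [ZModModule.add_self, smul_zero]
  · simp only [IsAcyclic, not_forall, not_not] at hac
    obtain ⟨v, w, hw⟩ := hac
    have hle : H ≤ G := by
      intro a b hab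
      rw [hH, fromEdgeSet_adj] at hab
      obtain ⟨⟨e, -, he⟩, -⟩ := hab
      have := e.2
      rwa [he] at this
    have h1 : G.egirth ≤ w.length := (egirth_anti hle).trans (egirth_le_length hw)
    refine h1.trans ?_
    norm_cast
    rw [← Walk.length_edges, ← List.toFinset_card_of_nodup hw.isTrail.edges_nodup,
      ← Finset.card_map (Function.Embedding.subtype _)]
    apply Finset.card_le_card
    intro x hx
    have := w.edges_subset_edgeSet (List.mem_toFinset.mp hx)
    rw [hH, edgeSet_fromEdgeSet] at this
    obtain ⟨⟨e, he, rfl⟩, -⟩ := this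
    exact Finset.mem_map_of_mem _ he

/-- The face-counting half of Euler's formula, in the form of Mac Lane's planarity criterion. If the
cycle space is spanned by cycles `C f` (the face boundaries) and every edge `e` lies on at most the
two of them indexed by `l e` and `r e`, then there are at least `dim Z ≥ |E| - |V|` nonzero face
boundaries, each of them has at least `g` edges, and together they have at most `2 |E|`. -/
theorem mul_card_edgeSet_le_of_faces [Fintype V] {G : SimpleGraph V} {s t : G.edgeSet → V}
    (hst : ∀ e : G.edgeSet, (e : Sym2 V) = s(s e, t e)) {F : Type*} (l r : G.edgeSet → F)
    (C : F → G.edgeSet →₀ ZMod 2) (hC : ∀ f, boundary s t (C f) = 0)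
    (hlr : ∀ f e, C f e ≠ 0 → f = l e ∨ f = r e)
    (hspan : LinearMap.ker (boundary s t) ≤ Submodule.span (ZMod 2) (Set.range C))
    {g : ℕ} (hg : (g : ℕ∞) ≤ G.egirth) :
    g * Nat.card G.edgeSet ≤ 2 * Nat.card G.edgeSet + g * Fintype.card V := by
  classical
  have : Fintype G.edgeSet := Fintype.ofFinite _
  rw [Nat.card_eq_fintype_card]
  set Φ : Finset F := (Finset.univ.image l ∪ Finset.univ.image r).filter fun f => C f ≠ 0 with hΦ
  have hmem : ∀ f, C f ≠ 0 → f ∈ Φ := by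
    intro f hf
    obtain ⟨e, he⟩ := Finsupp.ne_iff.mp hf
    rw [hΦ, Finset.mem_filter]
    refine ⟨?_, hf⟩
    rcases hlr f e (by simpa using he) with h | h <;> simp [h]
  have hdim : Fintype.card G.edgeSet ≤ Fintype.card V + Φ.card := by
    have h1 := (boundary s t).finrank_range_add_finrank_ker
    have h2 := Submodule.finrank_le (LinearMap.range (boundary s t))
    have h3 : Module.finrank (ZMod 2) (LinearMap.ker (boundary s t)) ≤ Φ.card := by
      have hle : LinearMap.ker (boundary s t) ≤
          Submodule.span (ZMod 2) ((Φ.image C : Finset _) : Set (G.edgeSet →₀ ZMod 2)) := by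
        refine hspan.trans (Submodule.span_le.mpr ?_)
        rintro _ ⟨f, rfl⟩
        by_cases hf : C f = 0
        · rw [hf]; exact Submodule.zero_mem _
        · exact Submodule.subset_span (Finset.mem_coe.mpr (Finset.mem_image_of_mem _ (hmem f hf)))
      exact (Submodule.finrank_mono hle).trans
        ((finrank_span_finset_le_card _).trans Finset.card_image_le)
    rw [Module.finrank_finsupp_self] at h1 h2
    omega
  have hcount : g * Φ.card ≤ 2 * Fintype.card G.edgeSet := by
    have h1 : ∑ f ∈ Φ, (C f).support.card ≤ ∑ e : G.edgeSet, 2 := by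
      have : ∀ f, (C f).support.card = ∑ e : G.edgeSet, if C f e ≠ 0 then 1 else 0 := by
        intro f
        rw [← Finset.sum_filter, ← Finset.card_eq_sum_ones]
        congr 1
        ext e
        simp
      simp only [this]
      rw [Finset.sum_comm]
      refine Finset.sum_le_sum fun e _ => ?_
      rw [← Finset.sum_filter, ← Finset.card_eq_sum_ones]
      refine (Finset.card_le_card (t := {l e, r e}) fun f hf => ?_).trans Finset.card_le_two
      simpa using hlr f e (Finset.mem_filter.mp hf).2
    have h2 : Φ.card * g ≤ ∑ f ∈ Φ, (C f).support.card := by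
      rw [← smul_eq_mul]
      refine Finset.card_nsmul_le_sum _ _ _ fun f hf => ?_
      have := hg.trans (egirth_le_card_support hst (Finset.mem_filter.mp hf).2 (hC f))
      exact_mod_cast this
    simp only [Finset.sum_const, Finset.card_univ, smul_eq_mul] at h1
    linarith
  nlinarith

end SimpleGraph

/-! ### Sparsity of minors of a host with faces -/

namespace SimpleGraph

/-- `A` is connected for the relation `R`, expressed as an induction principle: a property that
passes along `R`-steps inside `A` passes between any two elements of `A`. -/
def IsLinked {X : Type*} (R : X → X → Prop) (A : Set X) : Prop :=
  ∀ P : X → Prop, (∀ x ∈ A, ∀ y ∈ A, R x y → P x → P y) → ∀ x ∈ A, ∀ y ∈ A, P x → P y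

/-- Adjacency in the multigraph in which the edge `y` has the ends `a y` and `b y`. -/
def EdgeRel {X Y : Type*} (a b : Y → X) (x x' : X) : Prop :=
  ∃ y, (a y = x ∧ b y = x') ∨ (a y = x' ∧ b y = x)

lemma linearCombination_eq_zero_of {E M : Type*} [AddCommGroup M] [Module (ZMod 2) M]
    {f : E → M} {z : E →₀ ZMod 2} (h : ∀ e, z e = 0 ∨ f e = 0) :
    Finsupp.linearCombination (ZMod 2) f z = 0 := by
  rw [Finsupp.linearCombination_apply]
  refine Finset.sum_eq_zero fun e _ => ?_
  rcases h e with h | h <;> simp [h]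

lemma exists_boundary_eq_of_isLinked {X Y : Type*} {a b : Y → X} {A : Set X}
    (hA : IsLinked (EdgeRel a b) A) {x x' : X} (hx : x ∈ A) (hx' : x' ∈ A) :
    ∃ w : Y →₀ ZMod 2, boundary a b w = Finsupp.single x 1 + Finsupp.single x' 1 ∧
      ∀ y, w y ≠ 0 → a y ∈ A ∧ b y ∈ A := by
  classical
  refine hA (fun x' => ∃ w : Y →₀ ZMod 2,
    boundary a b w = Finsupp.single x 1 + Finsupp.single x' 1 ∧
      ∀ y, w y ≠ 0 → a y ∈ A ∧ b y ∈ A) ?_ x hx x' hx' ?_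
  · rintro u hu v hv ⟨y, hy⟩ ⟨w, hw, hwA⟩
    refine ⟨w + Finsupp.single y 1, ?_, fun y' hy' => ?_⟩
    · have h1 : boundary a b (Finsupp.single y 1) = Finsupp.single u 1 + Finsupp.single v 1 := by
        rw [boundary_single]
        rcases hy with ⟨rfl, rfl⟩ | ⟨rfl, rfl⟩
        · rfl
        · exact add_comm _ _
      rw [map_add, hw, h1, add_add_add_comm, add_assoc, ← add_assoc _ _ (Finsupp.single v 1),
        add_left_comm (Finsupp.single x 1)]
      rw [← add_assoc, ZModModule.add_self, zero_add]
    · by_cases h : w y' = 0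
      · have : y = y' := by
          by_contra hne
          exact hy' (by simp [h, hne])
        subst this
        rcases hy with ⟨rfl, rfl⟩ | ⟨rfl, rfl⟩
        · exact ⟨hu, hv⟩
        · exact ⟨hv, hu⟩
      · exact hwA y' h
  · exact ⟨0, by rw [map_zero, ZModModule.add_self], by simp⟩

/-- Sparsity of the minors of a host with exact face structure. In the host, with vertices `X`,
edges `Y` and faces `S`, the edge `y` has the ends `a y`, `b y` and the sides `l y`, `r y`;
`exact_host` says that the cycles are precisely the finitely supported boundaries of sets of faces.
The graph `G` is a minor of the host, with connected branch sets `B v` and the host edge `ι e`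
representing the edge `e`.

The faces of `G` are the classes of host faces obtained by merging across every deleted edge, that
is, every edge neither in the range of `ι` nor inside a branch set. Boundaries of classes restrict
to cycles of `G`, by contracting the branch sets. They span the cycle space, since a cycle of `G`
lifts to the host by joining its edges through the branch sets, and a set of host faces whose
boundary avoids the deleted edges is a union of classes. -/
theorem mul_card_edgeSet_le_of_branchSets {V X Y S : Type*} [Fintype V] {G : SimpleGraph V}
    {a b : Y → X} {l r : Y → S}
    (exact_host : ∀ z : Y →₀ ZMod 2,
      boundary a b z = 0 ↔ ∃ σ : S → ZMod 2, ∀ y, z y = σ (l y) + σ (r y))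
    (hfin : ∀ A : Set X, A.Finite → {y | a y ∈ A ∧ b y ∈ A}.Finite)
    {B : V → Set X} (Bfin : ∀ v, (B v).Finite) (Bne : ∀ v, (B v).Nonempty)
    (Bdisj : ∀ v w x, x ∈ B v → x ∈ B w → v = w)
    (Blinked : ∀ v, IsLinked (EdgeRel a b) (B v))
    {s t : G.edgeSet → V} (hst : ∀ e : G.edgeSet, (e : Sym2 V) = s(s e, t e))
    {ι : G.edgeSet → Y} (hs : ∀ e, a (ι e) ∈ B (s e)) (ht : ∀ e, b (ι e) ∈ B (t e))
    {g : ℕ} (hg : (g : ℕ∞) ≤ G.egirth) :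
    g * Nat.card G.edgeSet ≤ 2 * Nat.card G.edgeSet + g * Fintype.card V := by
  classical
  have hne := ne_of_forall_edge_eq hst
  have hinj : Function.Injective ι := fun e f h => by
    refine Subtype.ext ?_
    rw [hst e, hst f, Bdisj _ _ _ (hs e) (h ▸ hs f), Bdisj _ _ _ (ht e) (h ▸ ht f)]
  -- `J` consists of the contracted edges, `D` of the deleted ones.
  set J : Set Y := {y | ∃ v, a y ∈ B v ∧ b y ∈ B v} with hJ
  have hιJ : ∀ e, ι e ∉ J := by
    rintro e ⟨v, h1, h2⟩
    exact hne e ((Bdisj _ _ _ (hs e) h1).trans (Bdisj _ _ _ (ht e) h2).symm)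
  have hJfin : J.Finite := by
    have : J = ⋃ v, {y | a y ∈ B v ∧ b y ∈ B v} := by ext y; simp [hJ]
    rw [this]
    exact Set.finite_iUnion fun v => hfin _ (Bfin v)
  set D : Set Y := {y | y ∉ Set.range ι ∧ y ∉ J} with hD
  set q : S → Quot (fun c c' : S => ∃ y ∈ D, l y = c ∧ r y = c') := Quot.mk _ with hq
  have hqD : ∀ y ∈ D, q (l y) = q (r y) := fun y hy => Quot.sound ⟨y, hy, rfl, rfl⟩
  let ind (κ) (c : S) : ZMod 2 := if q c = κ then 1 else 0
  let C (κ) : G.edgeSet →₀ ZMod 2 :=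
    Finsupp.equivFunOnFinite.symm fun e => ind κ (l (ι e)) + ind κ (r (ι e))
  have hCapp : ∀ κ e, C κ e = ind κ (l (ι e)) + ind κ (r (ι e)) := fun κ e => rfl
  refine mul_card_edgeSet_le_of_faces hst (fun e => q (l (ι e))) (fun e => q (r (ι e))) C
    (fun κ => ?_) (fun κ e h => ?_) (fun z hz => ?_) hg
  · have hzD : ∀ y ∈ D, ind κ (l y) + ind κ (r y) = 0 := fun y hy => by
      simp only [ind, hqD y hy]
      exact ZModModule.add_self _
    have hsupp : (Function.support fun y => ind κ (l y) + ind κ (r y)).Finite := by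
      refine ((Set.finite_range ι).union hJfin).subset fun y hy => ?_
      by_contra h
      rw [Set.mem_union, not_or] at h
      exact hy (hzD y h)
    set z : Y →₀ ZMod 2 := Finsupp.ofSupportFinite _ hsupp with hz
    have hzapp : ∀ y, z y = ind κ (l y) + ind κ (r y) := fun y => rfl
    have hz0 : boundary a b z = 0 := (exact_host z).mpr ⟨ind κ, fun y => rfl⟩
    -- `χ` contracts each branch set `B v` to `v` and kills the other host vertices.
    let χ (x : X) : V →₀ ZMod 2 := if h : ∃ v, x ∈ B v then Finsupp.single h.choose 1 else 0
    have hχ : ∀ v, ∀ x ∈ B v, χ x = Finsupp.single v 1 := fun v x hx => by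
      have h : ∃ v, x ∈ B v := ⟨v, hx⟩
      simp only [χ, dif_pos h]
      rw [Bdisj _ _ _ h.choose_spec hx]
    have h1 := linearCombination_boundary a b χ z
    rw [hz0, map_zero] at h1
    have h2 : Finsupp.linearCombination (ZMod 2) (fun y => χ (a y) + χ (b y))
        (z - Finsupp.mapDomain ι (C κ)) = 0 := by
      refine linearCombination_eq_zero_of fun y => ?_
      by_cases hy : y ∈ Set.range ι
      · obtain ⟨e, rfl⟩ := hy
        left
        rw [Finsupp.sub_apply, Finsupp.mapDomain_apply hinj, hzapp, hCapp, sub_self]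
      · by_cases hyJ : y ∈ J
        · right
          obtain ⟨v, hv1, hv2⟩ := hyJ
          rw [hχ v _ hv1, hχ v _ hv2, ZModModule.add_self]
        · left
          rw [Finsupp.sub_apply, Finsupp.mapDomain_of_notMem_range _ _ hy, hzapp, hzD y ⟨hy, hyJ⟩,
            sub_self]
    rw [map_sub, ← h1, zero_sub, neg_eq_zero, Finsupp.linearCombination_mapDomain] at h2
    rw [← h2, boundary]
    congr 2
    ext1 e
    simp only [Function.comp_apply]
    rw [hχ _ _ (hs e), hχ _ _ (ht e)]
  · by_contra hcon
    rw [not_or] at hcon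
    refine h ?_
    rw [hCapp]
    simp only [ind]
    rw [if_neg (Ne.symm hcon.1), if_neg (Ne.symm hcon.2), add_zero]
  · choose root hroot using Bne
    -- `w v x` is a chain of contracted edges that joins `x ∈ B v` to the root of `B v`.
    have hw : ∀ v x, ∃ w : Y →₀ ZMod 2, x ∈ B v →
        boundary a b w = Finsupp.single x 1 + Finsupp.single (root v) 1 ∧ ∀ y, w y ≠ 0 → y ∈ J := by
      intro v x
      by_cases hx : x ∈ B v
      · obtain ⟨w, h1, h2⟩ := exists_boundary_eq_of_isLinked (Blinked v) hx (hroot v)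
        exact ⟨w, fun _ => ⟨h1, fun y hy => ⟨v, h2 y hy⟩⟩⟩
      · exact ⟨0, fun h => absurd h hx⟩
    choose w hw using hw
    -- `u e` lifts the edge `e` to a chain between the roots of the branch sets of its ends.
    let u (e : G.edgeSet) : Y →₀ ZMod 2 :=
      Finsupp.single (ι e) 1 + w (s e) (a (ι e)) + w (t e) (b (ι e))
    have huJ : ∀ e, ∀ y ∉ J, u e y = if ι e = y then 1 else 0 := fun e y hy => by
      have h1 : w (s e) (a (ι e)) y = 0 := by
        by_contra h
        exact hy ((hw _ _ (hs e)).2 y h)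
      have h2 : w (t e) (b (ι e)) y = 0 := by
        by_contra h
        exact hy ((hw _ _ (ht e)).2 y h)
      simp only [u, Finsupp.add_apply, h1, h2, add_zero, Finsupp.single_apply]
    set z' := Finsupp.linearCombination (ZMod 2) u z with hz'
    have hz'app : ∀ y, z' y = z.sum fun e c => c * u e y := fun y => by
      rw [hz', Finsupp.linearCombination_apply, Finsupp.sum_apply]
      rfl
    have hb : boundary a b z' = 0 := by
      have hcomp : boundary a b ∘ₗ Finsupp.linearCombination (ZMod 2) u =
          Finsupp.linearCombination (ZMod 2)
            (fun e =>
              Finsupp.single (root (s e)) 1 + Finsupp.single (root (t e)) (1 : ZMod 2)) := by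
        ext1 e
        ext1
        simp only [LinearMap.comp_apply, Finsupp.lsingle_apply, Finsupp.linearCombination_single,
          one_smul, u, map_add, (hw _ _ (hs e)).1, (hw _ _ (ht e)).1, boundary_single]
        generalize Finsupp.single (a (ι e)) (1 : ZMod 2) = p
        generalize Finsupp.single (b (ι e)) (1 : ZMod 2) = p'
        generalize Finsupp.single (root (s e)) (1 : ZMod 2) = c
        generalize Finsupp.single (root (t e)) (1 : ZMod 2) = c'
        calc p + p' + (p + c) + (p' + c') = (p + p) + (p' + p') + (c + c') := by abel
          _ = c + c' := by rw [ZModModule.add_self, ZModModule.add_self, zero_add, zero_add]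
      rw [hz', ← LinearMap.comp_apply, hcomp,
        ← linearCombination_boundary s t (fun v => Finsupp.single (root v) (1 : ZMod 2)),
        LinearMap.mem_ker.mp hz, map_zero]
    obtain ⟨σ, hσ⟩ := (exact_host z').mp hb
    have hσD : ∀ c c' : S, (∃ y ∈ D, l y = c ∧ r y = c') → σ c = σ c' := by
      rintro _ _ ⟨y, hy, rfl, rfl⟩
      have h0 : z' y = 0 := by
        rw [hz'app]
        refine Finset.sum_eq_zero fun e _ => ?_
        simp only
        rw [huJ e y hy.2, if_neg fun h => hy.1 ⟨e, h⟩, mul_zero]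
      rw [hσ y] at h0
      have := ZModModule.add_self (σ (r y))
      rw [← h0] at this
      exact (add_right_cancel this).symm
    have hze : ∀ e, z e = σ (l (ι e)) + σ (r (ι e)) := fun e => by
      rw [← hσ, hz'app, Finsupp.sum, Finset.sum_eq_single e]
      · rw [huJ e _ (hιJ e), if_pos rfl, mul_one]
      · intro f _ hf
        rw [huJ f _ (hιJ e), if_neg fun h => hf (hinj h), mul_zero]
      · intro h
        rw [Finsupp.notMem_support_iff.mp h, zero_mul]
    let σ' := Quot.lift σ hσD
    have : Fintype G.edgeSet := Fintype.ofFinite _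
    set Φ := Finset.univ.image (fun e => q (l (ι e))) ∪ Finset.univ.image (fun e => q (r (ι e)))
    have hsum : z = ∑ κ ∈ Φ, σ' κ • C κ := by
      ext e
      rw [Finsupp.finsetSum_apply, hze]
      simp only [Finsupp.smul_apply, hCapp, mul_add, Finset.sum_add_distrib, ind, smul_eq_mul,
        mul_ite, mul_one, mul_zero, Finset.sum_ite_eq]
      rw [if_pos (by simp [Φ]), if_pos (by simp [Φ])]
    rw [hsum]
    exact Submodule.sum_mem _ fun κ _ =>
      Submodule.smul_mem _ _ (Submodule.subset_span (Set.mem_range_self κ))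

end SimpleGraph

/-! ### The cycle space of the square grid -/

namespace SimpleGraph

namespace PlaneGrid

/-- The edges of the grid on `ℤ × ℤ`: `(p, false)` is the horizontal edge that starts at `p`, and
`(p, true)` the vertical one. -/
abbrev Edge : Type := (ℤ × ℤ) × Bool

/-- The left or lower end of an edge. -/
def tail (y : Edge) : ℤ × ℤ := y.1

/-- The right or upper end of an edge. -/
def head : Edge → ℤ × ℤ
  | (p, false) => (p.1 + 1, p.2)
  | (p, true) => (p.1, p.2 + 1)

/-- One of the two unit squares along an edge; a unit square is named by its lower left corner. For
a horizontal edge this is the square above it, for a vertical edge the square to its right. -/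
def left (y : Edge) : ℤ × ℤ := y.1

/-- The other unit square along an edge: the one below a horizontal edge, or to the left of a
vertical edge. -/
def right : Edge → ℤ × ℤ
  | (p, false) => (p.1, p.2 - 1)
  | (p, true) => (p.1 - 1, p.2)

lemma boundary_apply (z : Edge →₀ ZMod 2) (i j : ℤ) :
    boundary tail head z (i, j) =
      z ((i, j), false) + z ((i - 1, j), false) + z ((i, j), true) + z ((i, j - 1), true) := by
  classical
  induction z using Finsupp.induction_linear with
  | zero => simp
  | add f g hf hg => rw [map_add, Finsupp.add_apply, hf, hg]; simp only [Finsupp.add_apply]; ring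
  | single y c =>
    obtain ⟨⟨k, m⟩, d⟩ := y
    cases d <;>
    simp [tail, head, Finsupp.single_apply, Prod.ext_iff, eq_sub_iff_add_eq]

/-- Cycles of the grid are the finitely supported boundaries of sets of unit squares. The set that
bounds `z` consists of the squares with an odd number of edges of `z` straight below them. -/
lemma boundary_eq_zero_iff (z : Edge →₀ ZMod 2) :
    boundary tail head z = 0 ↔
      ∃ σ : ℤ × ℤ → ZMod 2, ∀ y, z y = σ (left y) + σ (right y) := by
  classical
  constructor
  · intro hz
    let σ (p : ℤ × ℤ) : ZMod 2 := Finsupp.linearCombination (ZMod 2)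
      (fun y : Edge => if y.2 = false ∧ y.1.1 = p.1 ∧ y.1.2 ≤ p.2 then (1 : ZMod 2) else 0) z
    refine ⟨σ, ?_⟩
    rintro ⟨⟨i, j⟩, d⟩
    cases d with
    | false =>
      simp only [left, right, σ]
      clear hz σ
      induction z using Finsupp.induction_linear with
      | zero => simp
      | add f g hf hg => simp only [map_add, Finsupp.add_apply, hf, hg]; ring
      | single y c =>
        obtain ⟨⟨k, m⟩, d⟩ := y
        simp only [Finsupp.linearCombination_single, Finsupp.single_apply, Prod.mk.injEq]
        have h2 : c + c = 0 := ZModModule.add_self c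
        split_ifs <;> simp_all <;> omega
    | true =>
      simp only [left, right, σ]
      obtain ⟨χ, hχ⟩ : ∃ χ : ℤ × ℤ → ZMod 2,
          ∀ k m, χ (k, m) = if k = i ∧ m ≤ j then 1 else 0 :=
        ⟨fun x => if x.1 = i ∧ x.2 ≤ j then 1 else 0, fun _ _ => rfl⟩
      -- `χ` is the indicator of the vertical ray going down from `(i, j)`.
      have h := linearCombination_boundary tail head χ z
      rw [hz, map_zero] at h
      refine CharTwo.add_eq_zero.mp (Eq.trans ?_ h.symm)
      clear h hz σ
      induction z using Finsupp.induction_linear with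
      | zero => simp
      | add f g hf hg =>
        simp only [map_add, Finsupp.add_apply] at hf hg ⊢
        linear_combination hf + hg
      | single y c =>
        obtain ⟨⟨k, m⟩, d⟩ := y
        have h2 : c + c = 0 := ZModModule.add_self c
        simp only [Finsupp.linearCombination_single, Finsupp.single_apply, Prod.mk.injEq]
        cases d <;>
        simp only [tail, head, hχ, reduceCtorEq, true_and, false_and, and_false, and_true, if_false,
          smul_eq_mul, mul_add, mul_ite, mul_one, mul_zero, zero_add] <;>
        split_ifs <;> first | (exfalso; omega) | simp [h2]
  · rintro ⟨σ, hσ⟩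
    ext ⟨i, j⟩
    rw [boundary_apply]
    simp only [hσ, left, right, Finsupp.zero_apply]
    generalize σ (i, j) = a
    generalize σ (i, j - 1) = b
    generalize σ (i - 1, j) = c
    generalize σ (i - 1, j - 1) = d
    revert a b c d
    decide

lemma finite_edges {A : Set (ℤ × ℤ)} (hA : A.Finite) :
    {y : Edge | tail y ∈ A ∧ head y ∈ A}.Finite :=
  (hA.prod Set.finite_univ).subset fun _ hy => ⟨hy.1, Set.mem_univ _⟩

end PlaneGrid
end SimpleGraph

/-! ### From plane drawings to minors of the grid -/

open scoped Topology

namespace SimpleGraph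

/-- From vertex regions and edge regions to the branch sets of a minor: if every edge region `P e`
is connected and meets the vertex regions of both ends of `e`, it suffices to add to the region of
`t e` the part of `P e` that can be reached from there before the region of `s e`. -/
theorem IsLinked.exists_branchSets {V E X : Type*} {R : X → X → Prop} (hR : ∀ x y, R x y → R y x)
    {s t : E → V} (hne : ∀ e, s e ≠ t e) {B : V → Set X} {P : E → Set X}
    (hB : ∀ v, IsLinked R (B v)) (hP : ∀ e, IsLinked R (P e))
    (hBB : ∀ v w, v ≠ w → Disjoint (B v) (B w)) (hPP : ∀ e f, e ≠ f → Disjoint (P e) (P f))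
    (hPB : ∀ e v, v ≠ s e → v ≠ t e → Disjoint (P e) (B v))
    (hs : ∀ e, (P e ∩ B (s e)).Nonempty) (ht : ∀ e, (P e ∩ B (t e)).Nonempty) :
    ∃ B' : V → Set X, (∀ v, B v ⊆ B' v) ∧ (∀ v, B' v ⊆ B v ∪ ⋃ e, P e) ∧
      (∀ v, IsLinked R (B' v)) ∧ (∀ v w x, x ∈ B' v → x ∈ B' w → v = w) ∧
      ∀ e, ∃ x ∈ B' (s e), ∃ y ∈ B' (t e), R x y := by
  choose c hcP hcB using ht
  let T (e : E) : Set X :=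
    {x | Relation.ReflTransGen (fun x y => R x y ∧ y ∈ P e ∧ y ∉ B (s e)) (c e) x}
  have hT : ∀ e, ∀ x ∈ T e, x ∈ P e ∧ x ∉ B (s e) := by
    intro e x hx
    cases hx with
    | refl => exact ⟨hcP e, fun h => Set.disjoint_left.mp (hBB _ _ (hne e)) h (hcB e)⟩
    | tail _ h => exact h.2
  have hTB : ∀ e v x, x ∈ T e → x ∈ B v → t e = v := by
    intro e v x hx hv
    by_contra h
    by_cases hv' : v = s e
    · exact (hT e x hx).2 (hv' ▸ hv)
    · exact Set.disjoint_left.mp (hPB e v hv' (Ne.symm h)) (hT e x hx).1 hv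
  let B' (v : V) : Set X := B v ∪ ⋃ e, {x | t e = v ∧ x ∈ T e}
  have hB'mem : ∀ v x, x ∈ B' v ↔ x ∈ B v ∨ ∃ e, t e = v ∧ x ∈ T e := fun v x => by
    simp [B']
  refine ⟨B', fun v => Set.subset_union_left, fun v x hx => ?_, fun v => ?_, fun v w x hv hw => ?_,
    fun e => ?_⟩
  · rcases (hB'mem v x).mp hx with h | ⟨e, -, h⟩
    · exact Or.inl h
    · exact Or.inr (Set.mem_iUnion.mpr ⟨e, (hT e x h).1⟩)
  · intro Q hQ
    have key : ∀ x ∈ B' v, ∃ x' ∈ B v, (Q x ↔ Q x') := by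
      intro x hx
      rcases (hB'mem v x).mp hx with h | ⟨e, rfl, h⟩
      · exact ⟨x, h, Iff.rfl⟩
      · refine ⟨c e, hcB e, ?_⟩
        have hsub : ∀ z ∈ T e, z ∈ B' (t e) := fun z hz => (hB'mem _ z).mpr (Or.inr ⟨e, rfl, hz⟩)
        clear hx
        induction h with
        | refl => rfl
        | @tail y z hy hyz ih =>
          have hz : z ∈ T e := hy.tail hyz
          refine Iff.trans ?_ ih
          exact ⟨hQ z (hsub z hz) y (hsub y hy) (hR _ _ hyz.1),
            hQ y (hsub y hy) z (hsub z hz) hyz.1⟩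
    intro x hx y hy hQx
    obtain ⟨x', hx', hxx⟩ := key x hx
    obtain ⟨y', hy', hyy⟩ := key y hy
    exact hyy.mpr (hB v Q (fun a ha b hb => hQ a (Or.inl ha) b (Or.inl hb)) x' hx' y' hy'
      (hxx.mp hQx))
  · rcases (hB'mem v x).mp hv with h | ⟨e, rfl, h⟩ <;>
      rcases (hB'mem w x).mp hw with h' | ⟨f, rfl, h'⟩
    · by_contra hvw
      exact Set.disjoint_left.mp (hBB v w hvw) h h'
    · exact (hTB f v x h' h).symm
    · exact hTB e w x h h'
    · by_contra hef
      exact Set.disjoint_left.mp (hPP e f fun h => hef (h ▸ rfl)) (hT e x h).1 (hT f x h').1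
  · by_contra hcon
    push Not at hcon
    obtain ⟨y, hyP, hyB⟩ := hs e
    refine (hT e y (hP e (· ∈ T e) ?_ (c e) (hcP e) y hyP Relation.ReflTransGen.refl)).2 hyB
    intro x hxP z hz hxz hx
    by_cases hzB : z ∈ B (s e)
    · exact absurd (hR _ _ hxz) (hcon z (Or.inl hzB) x ((hB'mem _ x).mpr (Or.inr ⟨e, rfl, hx⟩)))
    · exact Relation.ReflTransGen.tail hx ⟨hxz, hz, hzB⟩

namespace PlaneGrid

local notation "ℝ²" => EuclideanSpace ℝ (Fin 2)

/-- The closed square cell of side `h` with index `p` in the plane. -/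
def cell (h : ℝ) (p : ℤ × ℤ) : Set ℝ² :=
  {x | p.1 * h ≤ x 0 ∧ x 0 ≤ (p.1 + 1) * h ∧ p.2 * h ≤ x 1 ∧ x 1 ≤ (p.2 + 1) * h}

/-- The indices of the cells of side `h` that meet `K`. -/
def cells (h : ℝ) (K : Set ℝ²) : Set (ℤ × ℤ) := {p | (K ∩ cell h p).Nonempty}

lemma isClosed_cell (h : ℝ) (p : ℤ × ℤ) : IsClosed (cell h p) := by
  unfold cell
  have h0 : Continuous fun x : ℝ² => x 0 := by fun_prop
  have h1 : Continuous fun x : ℝ² => x 1 := by fun_prop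
  exact (isClosed_le continuous_const h0).inter ((isClosed_le h0 continuous_const).inter
    ((isClosed_le continuous_const h1).inter (isClosed_le h1 continuous_const)))

lemma exists_mem_cell {h : ℝ} (hh : 0 < h) (x : ℝ²) : ∃ p, x ∈ cell h p := by
  have key : ∀ y : ℝ, (⌊y / h⌋ : ℝ) * h ≤ y ∧ y ≤ (⌊y / h⌋ + 1) * h := fun y =>
    ⟨(le_div_iff₀ hh).mp (Int.floor_le _), (div_le_iff₀ hh).mp (Int.lt_floor_add_one _).le⟩
  exact ⟨(⌊x 0 / h⌋, ⌊x 1 / h⌋), (key _).1, (key _).2, (key _).1, (key _).2⟩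

lemma finite_cells {h : ℝ} (hh : 0 < h) {K : Set ℝ²} (hK : Bornology.IsBounded K) :
    (cells h K).Finite := by
  obtain ⟨R, hR⟩ := hK.exists_norm_le
  have key : ∀ (i : ℤ) (y : ℝ), |y| ≤ R → i * h ≤ y → y ≤ (i + 1) * h →
      i ∈ Set.Icc (⌊-R / h⌋ - 1) ⌈R / h⌉ := by
    intro i y hy h1 h2
    have hy' := abs_le.mp hy
    constructor
    · have h3 : (⌊-R / h⌋ : ℝ) * h ≤ (i + 1) * h :=
        ((le_div_iff₀ hh).mp (Int.floor_le _)).trans (hy'.1.trans h2)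
      have h4 : ⌊-R / h⌋ ≤ i + 1 := by exact_mod_cast le_of_mul_le_mul_right h3 hh
      omega
    · have h3 : (i : ℝ) * h ≤ ⌈R / h⌉ * h :=
        (h1.trans hy'.2).trans ((div_le_iff₀ hh).mp (Int.le_ceil _))
      exact_mod_cast le_of_mul_le_mul_right h3 hh
  refine ((Set.finite_Icc (⌊-R / h⌋ - 1) ⌈R / h⌉).prod
    (Set.finite_Icc (⌊-R / h⌋ - 1) ⌈R / h⌉)).subset ?_
  rintro p ⟨x, hxK, h1, h2, h3, h4⟩
  have hx : ∀ k, |x k| ≤ R := fun k =>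
    (Real.norm_eq_abs (x k) ▸ PiLp.norm_apply_le x k).trans (hR x hxK)
  exact ⟨key _ _ (hx 0) h1 h2, key _ _ (hx 1) h3 h4⟩

lemma edgeRel_symm (p q : ℤ × ℤ) (h : EdgeRel tail head p q) : EdgeRel tail head q p := by
  obtain ⟨y, h⟩ := h
  exact ⟨y, h.symm⟩

lemma edgeRel_fst {i i' j : ℤ} (h : i' = i + 1 ∨ i = i' + 1) :
    EdgeRel tail head (i, j) (i', j) := by
  rcases h with rfl | rfl
  · exact ⟨((i, j), false), Or.inl ⟨rfl, rfl⟩⟩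
  · exact ⟨((i', j), false), Or.inr ⟨rfl, rfl⟩⟩

lemma edgeRel_snd {i j j' : ℤ} (h : j' = j + 1 ∨ j = j' + 1) :
    EdgeRel tail head (i, j) (i, j') := by
  rcases h with rfl | rfl
  · exact ⟨((i, j), true), Or.inl ⟨rfl, rfl⟩⟩
  · exact ⟨((i, j'), true), Or.inr ⟨rfl, rfl⟩⟩

/-- The cells that meet a compact connected set are connected through common sides. If they fell
into two parts, two closed sets would cover `K`, so that some point of `K` would lie in a cell of
each part; but cells with a common point are joined through cells containing that point. -/
lemma isLinked_cells {h : ℝ} (hh : 0 < h) {K : Set ℝ²} (hK : IsCompact K)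
    (hconn : IsPreconnected K) : IsLinked (EdgeRel tail head) (cells h K) := by
  intro P hP p hp q hq hPp
  by_contra hPq
  have hfin := finite_cells hh hK.isBounded
  have hclosed : ∀ Q : ℤ × ℤ → Prop, IsClosed (⋃ p ∈ {p | p ∈ cells h K ∧ Q p}, cell h p) :=
    fun Q => (hfin.subset fun p hp => hp.1).isClosed_biUnion fun p _ => isClosed_cell h p
  have := isPreconnected_closed_iff.mp hconn _ _ (hclosed P) (hclosed fun p => ¬ P p) ?_ ?_ ?_
  · obtain ⟨x, hxK, hx1, hx2⟩ := this
    simp only [Set.mem_iUnion] at hx1 hx2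
    obtain ⟨⟨i, j⟩, ⟨h1, hP1⟩, h1x⟩ := hx1
    obtain ⟨⟨i', j'⟩, ⟨h2, hP2⟩, h2x⟩ := hx2
    have h3x : x ∈ cell h (i', j) := ⟨h2x.1, h2x.2.1, h1x.2.2.1, h1x.2.2.2⟩
    have h3 : (i', j) ∈ cells h K := ⟨x, hxK, h3x⟩
    have close : ∀ (a b : ℤ) (y : ℝ), a * h ≤ y → y ≤ (b + 1) * h → a ≤ b + 1 := by
      intro a b y ha hb
      exact_mod_cast le_of_mul_le_mul_right (ha.trans hb) hh
    have e1 := close _ _ _ h1x.1 h2x.2.1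
    have e2 := close _ _ _ h2x.1 h1x.2.1
    have e3 := close _ _ _ h1x.2.2.1 h2x.2.2.2
    have e4 := close _ _ _ h2x.2.2.1 h1x.2.2.2
    simp only at e1 e2 e3 e4
    have hP3 : P (i', j) := by
      by_cases hi : i = i'
      · exact hi ▸ hP1
      · exact hP _ h1 _ h3 (edgeRel_fst (by omega)) hP1
    apply hP2
    by_cases hj : j = j'
    · exact hj ▸ hP3
    · exact hP _ h3 _ h2 (edgeRel_snd (by omega)) hP3
  · intro x hx
    obtain ⟨p, hp⟩ := exists_mem_cell hh x
    have hpK : p ∈ cells h K := ⟨x, hx, hp⟩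
    by_cases hPp : P p
    · exact Or.inl (Set.mem_biUnion (show p ∈ {p | p ∈ cells h K ∧ P p} from ⟨hpK, hPp⟩) hp)
    · exact Or.inr (Set.mem_biUnion (show p ∈ {p | p ∈ cells h K ∧ ¬ P p} from ⟨hpK, hPp⟩) hp)
  · obtain ⟨x, hx, hxp⟩ := hp
    exact ⟨x, hx,
      Set.mem_biUnion (show p ∈ {p | p ∈ cells h K ∧ P p} from ⟨⟨x, hx, hxp⟩, hPp⟩) hxp⟩
  · obtain ⟨x, hx, hxp⟩ := hq
    exact ⟨x, hx,
      Set.mem_biUnion (show q ∈ {p | p ∈ cells h K ∧ ¬ P p} from ⟨⟨x, hx, hxp⟩, hPq⟩) hxp⟩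

lemma dist_le_of_mem_cell {h : ℝ} {p : ℤ × ℤ} {x y : ℝ²} (hx : x ∈ cell h p)
    (hy : y ∈ cell h p) : Dist.dist x y ≤ 2 * h := by
  obtain ⟨x1, x2, x3, x4⟩ := hx
  obtain ⟨y1, y2, y3, y4⟩ := hy
  have hh : 0 ≤ h := by linarith
  have d0 : (x 0 - y 0) ^ 2 ≤ h ^ 2 := sq_le_sq' (by linarith) (by linarith)
  have d1 : (x 1 - y 1) ^ 2 ≤ h ^ 2 := sq_le_sq' (by linarith) (by linarith)
  rw [EuclideanSpace.dist_eq, Real.sqrt_le_left (by linarith), Fin.sum_univ_two, Real.dist_eq,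
    Real.dist_eq, sq_abs, sq_abs]
  nlinarith

lemma eventually_disjoint_cells {K K' : Set ℝ²} (hK : IsCompact K) (hK' : IsCompact K')
    (hd : Disjoint K K') : ∀ᶠ h in 𝓝[>] (0 : ℝ), Disjoint (cells h K) (cells h K') := by
  obtain ⟨r, hr, hrK⟩ := Metric.exists_pos_forall_lt_edist hK hK'.isClosed hd
  have : Set.Ioo (0 : ℝ) (r / 2) ∈ 𝓝[>] (0 : ℝ) :=
    Ioo_mem_nhdsGT (by positivity)
  filter_upwards [this] with h hh
  rw [Set.disjoint_left]
  rintro p ⟨x, hx, hxp⟩ ⟨y, hy, hyp⟩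
  have h1 := hrK x hx y hy
  have h2 := dist_le_of_mem_cell hxp hyp
  rw [edist_nndist, ENNReal.coe_lt_coe, ← NNReal.coe_lt_coe, coe_nndist] at h1
  linarith [hh.2]

end PlaneGrid

lemma eventually_disjoint_closedBall {α : Type*} [PseudoMetricSpace α] {K : Set α}
    (hK : IsClosed K) {x : α} (hx : x ∉ K) :
    ∀ᶠ r in 𝓝[>] (0 : ℝ), Disjoint K (Metric.closedBall x r) := by
  obtain ⟨ε, hε, hball⟩ := Metric.isOpen_iff.mp hK.isOpen_compl x hx
  filter_upwards [Ioo_mem_nhdsGT hε] with r hr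
  rw [Set.disjoint_right]
  intro y hy
  exact hball (Metric.closedBall_subset_ball hr.2 hy)

/-- A drawing yields compact connected regions for vertices and edges: small disks around the
vertices, and the arcs cut off near their ends but still inside the disks there. Regions are
disjoint, except that the region of an edge meets those of its two ends. -/
theorem PlaneDrawing.exists_regions {V : Type*} [Finite V] {G : SimpleGraph V}
    (D : G.PlaneDrawing) :
    ∃ (s t : G.edgeSet → V) (B : V → Set (EuclideanSpace ℝ (Fin 2)))
      (P : G.edgeSet → Set (EuclideanSpace ℝ (Fin 2))),
      (∀ e : G.edgeSet, (e : Sym2 V) = s(s e, t e)) ∧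
      (∀ v, IsCompact (B v) ∧ IsPreconnected (B v) ∧ (B v).Nonempty) ∧
      (∀ e, IsCompact (P e) ∧ IsPreconnected (P e)) ∧
      (∀ v w, v ≠ w → Disjoint (B v) (B w)) ∧ (∀ e f, e ≠ f → Disjoint (P e) (P f)) ∧
      (∀ e v, v ≠ s e → v ≠ t e → Disjoint (P e) (B v)) ∧
      ∀ e, (P e ∩ B (s e)).Nonempty ∧ (P e ∩ B (t e)).Nonempty := by
  have hends : ∀ e : G.edgeSet, ∃ u v, (e : Sym2 V) = s(u, v) ∧ D.arc e 0 = D.point u ∧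
      D.arc e 1 = D.point v := by
    intro e
    have h := D.arc_ends e
    induction hx : (e : Sym2 V) using Sym2.ind with
    | _ u v =>
      rw [hx, Sym2.map_mk, Sym2.eq_iff] at h
      rcases h with ⟨h1, h2⟩ | ⟨h1, h2⟩
      · exact ⟨u, v, rfl, h1, h2⟩
      · exact ⟨v, u, Sym2.eq_swap, h1, h2⟩
  choose s t hst h0 h1 using hends
  have hmid : ∀ e v, v ≠ s e → v ≠ t e → D.point v ∉ Set.range (D.arc e) := by
    rintro e v hvs hvt ⟨x, hx⟩
    rcases eq_or_ne x 0 with rfl | hx0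
    · exact hvs (D.point_injective (hx.symm.trans (h0 e)))
    rcases eq_or_ne x 1 with rfl | hx1
    · exact hvt (D.point_injective (hx.symm.trans (h1 e)))
    exact D.arc_ne_point e x ⟨unitInterval.pos_iff_ne_zero.mpr hx0,
      unitInterval.lt_one_iff_ne_one.mpr hx1⟩ v hx
  have hev : ∀ᶠ r in 𝓝[>] (0 : ℝ),
      (∀ v w, v ≠ w → Disjoint (Metric.closedBall (D.point v) r)
        (Metric.closedBall (D.point w) r)) ∧
      ∀ e v, v ≠ s e → v ≠ t e →
        Disjoint (Set.range (D.arc e)) (Metric.closedBall (D.point v) r) := by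
    refine Filter.Eventually.and ?_ ?_
    · refine Filter.eventually_all.mpr fun v => Filter.eventually_all.mpr fun w => ?_
      by_cases hvw : v = w
      · exact Filter.Eventually.of_forall fun r h => absurd hvw h
      · have hd : 0 < Dist.dist (D.point v) (D.point w) := dist_pos.mpr (D.point_injective.ne hvw)
        filter_upwards [Ioo_mem_nhdsGT (half_pos hd)] with r hr _
        exact Metric.closedBall_disjoint_closedBall (by linarith [hr.2])
    · refine Filter.eventually_all.mpr fun e => Filter.eventually_all.mpr fun v => ?_
      by_cases hv : v ≠ s e ∧ v ≠ t e
      · have := eventually_disjoint_closedBall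
          (isCompact_range (D.arc_continuous e)).isClosed (hmid e v hv.1 hv.2)
        filter_upwards [this] with r hr _ _ using hr
      · exact Filter.Eventually.of_forall fun r ha hb => absurd ⟨ha, hb⟩ hv
  obtain ⟨r, ⟨hrB, hrA⟩, hr⟩ := (hev.and self_mem_nhdsWithin).exists
  -- The arcs as functions on `ℝ`, constant outside the unit interval.
  let γ (e : G.edgeSet) (x : ℝ) := D.arc e (Set.projIcc 0 1 zero_le_one x)
  have hγ : ∀ e, Continuous (γ e) := fun e => (D.arc_continuous e).comp continuous_projIcc
  have hclip : ∀ e, ∃ a : ℝ, 0 < a ∧ a < 1 / 2 ∧ γ e a ∈ Metric.closedBall (D.point (s e)) r ∧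
      γ e (1 - a) ∈ Metric.closedBall (D.point (t e)) r := by
    intro e
    have c0 : γ e 0 = D.point (s e) := by
      rw [← h0 e]
      exact congrArg _ (Set.projIcc_left _)
    have c1 : γ e (1 - 0) = D.point (t e) := by
      rw [← h1 e, sub_zero]
      exact congrArg _ (Set.projIcc_right _)
    have n0 : ∀ᶠ a in 𝓝[>] (0 : ℝ), γ e a ∈ Metric.closedBall (D.point (s e)) r :=
      nhdsWithin_le_nhds ((hγ e).continuousAt.preimage_mem_nhds
        (by rw [c0]; exact Metric.closedBall_mem_nhds _ hr))
    have hγ' : Continuous fun a => γ e (1 - a) :=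
      (hγ e).comp (continuous_const.sub continuous_id)
    have n1 : ∀ᶠ a in 𝓝[>] (0 : ℝ), γ e (1 - a) ∈ Metric.closedBall (D.point (t e)) r :=
      nhdsWithin_le_nhds (hγ'.continuousAt.preimage_mem_nhds
        (by rw [c1]; exact Metric.closedBall_mem_nhds _ hr))
    obtain ⟨a, ⟨ha0, ha1⟩, ha⟩ :=
      ((n0.and n1).and (Ioo_mem_nhdsGT (show (0 : ℝ) < 1 / 2 by norm_num))).exists
    exact ⟨a, ha.1, ha.2, ha0, ha1⟩
  choose a ha0 ha1 has hat using hclip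
  have hIoo : ∀ e, ∀ x ∈ Set.Icc (a e) (1 - a e),
      Set.projIcc (0 : ℝ) 1 zero_le_one x ∈ Set.Ioo (0 : unitInterval) 1 := by
    intro e x hx
    have hx0 : 0 < x := (ha0 e).trans_le hx.1
    have hx1 : x < 1 := hx.2.trans_lt (by linarith [ha0 e])
    rw [Set.projIcc_of_mem zero_le_one ⟨hx0.le, hx1.le⟩]
    exact ⟨hx0, hx1⟩
  refine ⟨s, t, fun v => Metric.closedBall (D.point v) r,
    fun e => γ e '' Set.Icc (a e) (1 - a e), hst, fun v => ⟨isCompact_closedBall _ _,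
      (convex_closedBall _ _).isPreconnected, ⟨_, Metric.mem_closedBall_self hr.le⟩⟩,
    fun e => ⟨isCompact_Icc.image (hγ e), isPreconnected_Icc.image _ (hγ e).continuousOn⟩, hrB,
    fun e f hef => ?_, fun e v hvs hvt => ?_, fun e => ⟨⟨_, ⟨a e, ?_, rfl⟩, has e⟩,
      ⟨_, ⟨1 - a e, ?_, rfl⟩, hat e⟩⟩⟩
  · rw [Set.disjoint_left]
    rintro _ ⟨x, hx, rfl⟩ ⟨y, hy, hxy⟩
    exact D.arc_ne_arc e f hef _ (hIoo e x hx) _ hxy.symm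
  · refine (hrA e v hvs hvt).mono_left ?_
    rintro _ ⟨x, -, rfl⟩
    exact Set.mem_range_self _
  · exact ⟨le_rfl, by linarith [ha1 e]⟩
  · exact ⟨by linarith [ha1 e], le_rfl⟩

/-- The girth bound for planar graphs, `g |E| ≤ 2 |E| + g |V|`; Euler's formula would give the
slightly stronger `g (|E| + 2) ≤ 2 |E| + g |V|` in the presence of a cycle. On a fine square grid,
the cells that meet the regions of a drawing exhibit the graph as a minor of the grid. -/
theorem IsPlanar.mul_card_edgeSet_le {V : Type*} [Fintype V] {G : SimpleGraph V}
    (hG : G.IsPlanar) {g : ℕ} (hg : (g : ℕ∞) ≤ G.egirth) :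
    g * Nat.card G.edgeSet ≤ 2 * Nat.card G.edgeSet + g * Fintype.card V := by
  obtain ⟨D⟩ := hG
  obtain ⟨s, t, B, P, hst, hB, hP, hBB, hPP, hPB, hmeet⟩ := D.exists_regions
  have hne := ne_of_forall_edge_eq hst
  have hev : ∀ᶠ h in 𝓝[>] (0 : ℝ),
      (∀ v w, v ≠ w → Disjoint (PlaneGrid.cells h (B v)) (PlaneGrid.cells h (B w))) ∧
      (∀ e f, e ≠ f → Disjoint (PlaneGrid.cells h (P e)) (PlaneGrid.cells h (P f))) ∧
      ∀ e v, v ≠ s e → v ≠ t e →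
        Disjoint (PlaneGrid.cells h (P e)) (PlaneGrid.cells h (B v)) := by
    simp only [Filter.eventually_and, Filter.eventually_all]
    exact ⟨fun v w hvw => PlaneGrid.eventually_disjoint_cells (hB v).1 (hB w).1 (hBB v w hvw),
      fun e f hef => PlaneGrid.eventually_disjoint_cells (hP e).1 (hP f).1 (hPP e f hef),
      fun e v h1 h2 => PlaneGrid.eventually_disjoint_cells (hP e).1 (hB v).1 (hPB e v h1 h2)⟩
  obtain ⟨h, ⟨hBB', hPP', hPB'⟩, hh⟩ := (hev.and self_mem_nhdsWithin).exists
  have hmeet' : ∀ {K K' : Set (EuclideanSpace ℝ (Fin 2))}, (K ∩ K').Nonempty →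
      (PlaneGrid.cells h K ∩ PlaneGrid.cells h K').Nonempty := by
    rintro K K' ⟨x, hx, hx'⟩
    obtain ⟨p, hp⟩ := PlaneGrid.exists_mem_cell hh x
    exact ⟨p, ⟨x, hx, hp⟩, ⟨x, hx', hp⟩⟩
  obtain ⟨B', hle, hge, hlink, hdisj, hedge⟩ := IsLinked.exists_branchSets PlaneGrid.edgeRel_symm
    hne (fun v => PlaneGrid.isLinked_cells hh (hB v).1 (hB v).2.1)
    (fun e => PlaneGrid.isLinked_cells hh (hP e).1 (hP e).2) hBB' hPP' hPB'
    (fun e => hmeet' (hmeet e).1) (fun e => hmeet' (hmeet e).2)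
  have hedge' : ∀ e : G.edgeSet, ∃ (y : PlaneGrid.Edge) (u v : V), (e : Sym2 V) = s(u, v) ∧
      PlaneGrid.tail y ∈ B' u ∧ PlaneGrid.head y ∈ B' v := by
    intro e
    obtain ⟨x, hx, x', hx', y, ⟨rfl, rfl⟩ | ⟨rfl, rfl⟩⟩ := hedge e
    · exact ⟨y, s e, t e, hst e, hx, hx'⟩
    · exact ⟨y, t e, s e, (hst e).trans Sym2.eq_swap, hx', hx⟩
  choose ι s' t' hst' hs' ht' using hedge'
  refine mul_card_edgeSet_le_of_branchSets PlaneGrid.boundary_eq_zero_iff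
    (fun _ => PlaneGrid.finite_edges) (fun v => ?_) (fun v => ?_) hdisj hlink hst' hs' ht' hg
  · exact ((PlaneGrid.finite_cells hh (hB v).1.isBounded).union
      (Set.finite_iUnion fun e => PlaneGrid.finite_cells hh (hP e).1.isBounded)).subset (hge v)
  · obtain ⟨x, hx⟩ := (hB v).2.2
    obtain ⟨p, hp⟩ := PlaneGrid.exists_mem_cell hh x
    exact ⟨p, hle v ⟨x, hx, hp⟩⟩

end SimpleGraph

/-! ### Sparse subcubic graphs and coloring of the square -/

namespace SimpleGraph

section Sparse

variable {V : Type*} {G : SimpleGraph V}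

lemma IsPlanar.induce (hG : G.IsPlanar) (S : Set V) : (G.induce S).IsPlanar := by
  obtain ⟨D⟩ := hG
  let φ : G.induce S ↪g G := Embedding.induce S
  exact ⟨{
    point := fun v => D.point v
    point_injective := D.point_injective.comp Subtype.val_injective
    arc := fun e => D.arc (φ.mapEdgeSet e)
    arc_continuous := fun e => D.arc_continuous _
    arc_injective := fun e => D.arc_injective _
    arc_ends := fun e => by
      rw [D.arc_ends, Embedding.mapEdgeSet_apply, Hom.mapEdgeSet_coe, Sym2.map_map]
      rfl
    arc_ne_point := fun e x hx v => D.arc_ne_point _ x hx v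
    arc_ne_arc := fun e f hef => D.arc_ne_arc _ _ (φ.mapEdgeSet.injective.ne hef) }⟩

lemma egirth_le_egirth_induce (S : Set V) : G.egirth ≤ (G.induce S).egirth :=
  IsContained.egirth_le ⟨(Embedding.induce S).toCopy⟩

/-- If all degrees are `2` or `3` and no two vertices of degree `2` are adjacent, then the numbers
of vertices of these degrees satisfy `2 n₂ ≤ 3 n₃`, so the average degree is at least `12 / 5`. For
girth at least `13` it is at most `26 / 11`, which is smaller. -/
theorem exists_degree_le_one_or_adj_degree_le_two [Fintype V] [Nonempty V] [DecidableRel G.Adj]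
    (hG : G.IsPlanar) (hdeg : ∀ v, G.degree v ≤ 3) (hgirth : 12 < G.egirth) :
    (∃ v, G.degree v ≤ 1) ∨ ∃ v w, G.Adj v w ∧ G.degree v ≤ 2 ∧ G.degree w ≤ 2 := by
  classical
  by_contra! hcon
  obtain ⟨hmin, hadj⟩ := hcon
  have hg : ((13 : ℕ) : ℕ∞) ≤ G.egirth := by
    have := Order.add_one_le_of_lt hgirth
    rwa [show (12 : ℕ∞) + 1 = ((13 : ℕ) : ℕ∞) from by norm_num] at this
  have hE := hG.mul_card_edgeSet_le hg
  rw [Nat.card_eq_fintype_card, ← edgeFinset_card] at hE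
  have hsum := G.sum_degrees_eq_twice_card_edges
  set A : Finset V := Finset.univ.filter fun v => G.degree v ≤ 2 with hA
  set B : Finset V := Finset.univ.filter fun v => ¬ G.degree v ≤ 2 with hB
  have hA2 : ∑ v ∈ A, G.degree v = 2 * A.card := by
    rw [mul_comm, ← smul_eq_mul, Finset.sum_const_nat (m := 2), smul_eq_mul]
    intro v hv
    have := hmin v
    have := (Finset.mem_filter.mp hv).2
    omega
  have hB3 : ∑ v ∈ B, G.degree v = 3 * B.card := by
    rw [mul_comm, ← smul_eq_mul, Finset.sum_const_nat (m := 3), smul_eq_mul]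
    intro v hv
    have := hdeg v
    have := (Finset.mem_filter.mp hv).2
    omega
  have hAB : A.card + B.card = Fintype.card V := by
    rw [hA, hB, Finset.card_filter_add_card_filter_not, Finset.card_univ]
  have hsplit : ∑ v ∈ A, G.degree v + ∑ v ∈ B, G.degree v = ∑ v, G.degree v :=
    Finset.sum_filter_add_sum_filter_not _ _ _
  have hcross : ∑ v ∈ A, G.degree v ≤ ∑ v ∈ B, G.degree v := by
    calc ∑ v ∈ A, G.degree v = ∑ v ∈ A, (B.bipartiteAbove G.Adj v).card := by
          refine Finset.sum_congr rfl fun v hv => ?_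
          rw [← card_neighborFinset_eq_degree]
          congr 1
          ext w
          simp only [mem_neighborFinset, Finset.mem_bipartiteAbove, hB, Finset.mem_filter,
            Finset.mem_univ, true_and]
          exact ⟨fun h => ⟨not_le.mpr (hadj v w h (Finset.mem_filter.mp hv).2), h⟩, fun h => h.2⟩
      _ = ∑ w ∈ B, (A.bipartiteBelow G.Adj w).card :=
          Finset.sum_card_bipartiteAbove_eq_sum_card_bipartiteBelow _
      _ ≤ ∑ w ∈ B, G.degree w := by
          refine Finset.sum_le_sum fun w _ => ?_
          rw [← card_neighborFinset_eq_degree]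
          refine Finset.card_le_card fun v hv => ?_
          rw [mem_neighborFinset]
          exact ((Finset.mem_bipartiteBelow _).mp hv).2.symm
  have := Fintype.card_pos (α := V)
  omega

lemma degree_induce_eq_card_filter [DecidableRel G.Adj] (S : Finset V)
    (v : (S : Set V)) [Fintype ((G.induce (S : Set V)).neighborSet v)] :
    (G.induce (S : Set V)).degree v = (S.filter fun w => G.Adj v w).card := by
  classical
  rw [← card_neighborFinset_eq_degree, ← Finset.card_map (Function.Embedding.subtype _)]
  congr 1
  ext w
  simp [and_comm]

end Sparse

section Coloring

variable {V : Type*} {G : SimpleGraph V}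

/-- `x` and `y` are adjacent in the square of `G`, with a common neighbour in `S` if they are not
adjacent in `G`. For `x, y ∈ S` this is adjacency in the square of `G.induce S`. -/
def SquareAdjIn (G : SimpleGraph V) (S : Finset V) (x y : V) : Prop :=
  x ≠ y ∧ (G.Adj x y ∨ ∃ m ∈ S, G.Adj x m ∧ G.Adj m y)

lemma SquareAdjIn.symm {S : Finset V} {x y : V} (h : G.SquareAdjIn S x y) :
    G.SquareAdjIn S y x := by
  obtain ⟨hne, h | ⟨m, hm, h1, h2⟩⟩ := h
  · exact ⟨hne.symm, Or.inl h.symm⟩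
  · exact ⟨hne.symm, Or.inr ⟨m, hm, h2.symm, h1.symm⟩⟩

open scoped Classical in
/-- A neighbour `m` of `v` accounts for itself and its neighbours other than `v`, hence for at most
as many vertices as its degree. -/
lemma card_squareAdjIn_le (S : Finset V) {v : V} (hv : v ∈ S) :
    (S.filter (G.SquareAdjIn S v)).card ≤
      ∑ m ∈ S.filter (G.Adj v), (S.filter (G.Adj m)).card := by
  refine (Finset.card_le_card (t := (S.filter (G.Adj v)).biUnion fun m =>
    insert m ((S.filter (G.Adj m)).erase v)) fun x hx => ?_).trans
      (Finset.card_biUnion_le.trans (Finset.sum_le_sum fun m hm => ?_))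
  · obtain ⟨hxS, hne, h | ⟨m, hm, h1, h2⟩⟩ := Finset.mem_filter.mp hx
    · exact Finset.mem_biUnion.mpr ⟨x, Finset.mem_filter.mpr ⟨hxS, h⟩, Finset.mem_insert_self _ _⟩
    · exact Finset.mem_biUnion.mpr ⟨m, Finset.mem_filter.mpr ⟨hm, h1⟩, Finset.mem_insert_of_mem
        (Finset.mem_erase.mpr ⟨hne.symm, Finset.mem_filter.mpr ⟨hxS, h2⟩⟩)⟩
  · refine (Finset.card_insert_le _ _).trans ?_
    rw [Finset.card_erase_add_one]
    exact Finset.mem_filter.mpr ⟨hv, (Finset.mem_filter.mp hm).2.symm⟩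

variable {C : Type} {L : V → Finset C} {H : SimpleGraph (Σ u : V, {c : C // c ∈ L u})}

/-- A colored neighbour forbids at most one color at `v`, as the edges between two lists form a
matching. -/
lemma IsCover.exists_color {F : SimpleGraph V} (hH : F.IsCover L H)
    (c : ∀ v, {c : C // c ∈ L v}) {v : V} {N : Finset V} (hv : v ∉ N) (hN : N.card < (L v).card) :
    ∃ a : {c : C // c ∈ L v}, ∀ x ∈ N, ¬ H.Adj ⟨x, c x⟩ ⟨v, a⟩ := by
  classical
  by_contra! hcon
  refine absurd hN (not_lt.mpr ?_)
  rw [← Fintype.card_coe, ← Finset.card_univ]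
  choose f hfN hf using hcon
  refine Finset.card_le_card_of_injOn f (fun a _ => hfN a) fun a _ b _ hab => ?_
  have h1 := hf a
  have h2 := hf b
  rw [← hab] at h2
  have hne : f a ≠ v := fun h => hv (h ▸ hfN a)
  have hadj : F.Adj (f a) v := by
    by_contra hF
    exact hH.not_adj _ _ hne hF _ _ h1
  exact hH.matching _ _ hadj _ _ _ h1 h2

lemma IsCover.exists_extend {F : SimpleGraph V} (hH : F.IsCover L H) [DecidableEq V]
    {R : V → V → Prop} [DecidableRel R] (hR : ∀ x y, R x y → R y x) (hirr : ∀ x, ¬ R x x)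
    {T : Finset V} {v : V} (hN : (T.filter (R v)).card < (L v).card)
    {c : ∀ v, {c : C // c ∈ L v}}
    (hc : ∀ x ∈ T, ∀ y ∈ T, R x y → ¬ H.Adj ⟨x, c x⟩ ⟨y, c y⟩) :
    ∃ c' : ∀ v, {c : C // c ∈ L v},
      ∀ x ∈ insert v T, ∀ y ∈ insert v T, R x y → ¬ H.Adj ⟨x, c' x⟩ ⟨y, c' y⟩ := by
  obtain ⟨a, ha⟩ := hH.exists_color c (fun h => hirr v (Finset.mem_filter.mp h).2) hN
  have hne : ∀ x y, R x y → x ≠ y := fun x y h hxy => hirr y (hxy ▸ h)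
  refine ⟨Function.update c v a, fun x hx y hy hxy => ?_⟩
  by_cases hxv : x = v
  · subst hxv
    have hyx : y ≠ x := (hne _ _ hxy).symm
    rw [Function.update_self, Function.update_of_ne hyx]
    have hyT := (Finset.mem_insert.mp hy).resolve_left hyx
    exact fun h => ha y (Finset.mem_filter.mpr ⟨hyT, hxy⟩) h.symm
  · have hxT := (Finset.mem_insert.mp hx).resolve_left hxv
    by_cases hyv : y = v
    · subst hyv
      rw [Function.update_self, Function.update_of_ne hxv]
      exact ha x (Finset.mem_filter.mpr ⟨hxT, hR _ _ hxy⟩)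
    · rw [Function.update_of_ne hxv, Function.update_of_ne hyv]
      exact hc x hxT y ((Finset.mem_insert.mp hy).resolve_left hyv) hxy

open scoped Classical in
/-- Deleting vertices that have at most one neighbour among the remaining ones does not remove edges
from the square of what remains. -/
lemma squareAdjIn_of_subset {S T : Finset V}
    (hT : ∀ m ∈ S, m ∉ T → (T.filter (G.Adj m)).card ≤ 1) {x y : V} (hx : x ∈ T) (hy : y ∈ T)
    (h : G.SquareAdjIn S x y) : G.SquareAdjIn T x y := by
  obtain ⟨hne, h | ⟨m, hm, h1, h2⟩⟩ := h
  · exact ⟨hne, Or.inl h⟩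
  · refine ⟨hne, Or.inr ⟨m, ?_, h1, h2⟩⟩
    by_contra hmT
    exact hne (Finset.card_le_one.mp (hT m hm hmT) x (Finset.mem_filter.mpr ⟨hx, h1.symm⟩)
      y (Finset.mem_filter.mpr ⟨hy, h2⟩))

open scoped Classical in
/-- Greedy coloring with six colors. A vertex of degree at most `1` has at most `3` neighbours in
the square. A vertex of degree at most `2` with a neighbour of degree at most `2` has at most
`2 + 3 = 5`; two such adjacent vertices are removed together, since removing only one of them could
destroy an edge of the square, and are colored last. -/
theorem IsCover.exists_partial_coloring {F : SimpleGraph V} (hH : F.IsCover L H)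
    (hL : ∀ v, 6 ≤ (L v).card)
    (hdeg : ∀ (S : Finset V) (v), (S.filter (G.Adj v)).card ≤ 3)
    (hred : ∀ S : Finset V, S.Nonempty → (∃ v ∈ S, (S.filter (G.Adj v)).card ≤ 1) ∨
      ∃ v ∈ S, ∃ w ∈ S, G.Adj v w ∧ (S.filter (G.Adj v)).card ≤ 2 ∧
        (S.filter (G.Adj w)).card ≤ 2) (S : Finset V) :
    ∃ c : ∀ v, {c : C // c ∈ L v},
      ∀ x ∈ S, ∀ y ∈ S, G.SquareAdjIn S x y → ¬ H.Adj ⟨x, c x⟩ ⟨y, c y⟩ := by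
  induction S using Finset.strongInduction with
  | H S ih =>
  have hmono : ∀ {T : Finset V} {v : V}, T ⊆ S → (T.filter (G.SquareAdjIn S v)).card ≤
      (S.filter (G.SquareAdjIn S v)).card := fun hT =>
    Finset.card_le_card (Finset.filter_subset_filter _ hT)
  rcases S.eq_empty_or_nonempty with rfl | hS
  · have hne : ∀ v, (L v).Nonempty := fun v => Finset.card_pos.mp (by have := hL v; omega)
    exact ⟨fun v => ⟨_, (hne v).choose_spec⟩, by simp⟩
  rcases hred S hS with ⟨v, hv, hv1⟩ | ⟨v, hv, w, hw, hvw, hv2, hw2⟩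
  · obtain ⟨c, hc⟩ := ih _ (Finset.erase_ssubset hv)
    have hsub : S.erase v ⊆ S := Finset.erase_subset _ _
    have hN : (S.filter (G.SquareAdjIn S v)).card ≤ 3 := by
      refine (card_squareAdjIn_le S hv).trans
        ((Finset.sum_le_card_nsmul _ _ 3 fun m _ => hdeg S m).trans ?_)
      rw [smul_eq_mul]
      omega
    have := hH.exists_extend (v := v) (R := G.SquareAdjIn S) (fun _ _ => SquareAdjIn.symm)
      (fun _ h => h.1 rfl) (by have := hL v; have := hmono (v := v) hsub; omega)
      (fun x hx y hy hxy => hc x hx y hy (squareAdjIn_of_subset (fun m hm hmT => ?_) hx hy hxy))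
    · rwa [Finset.insert_erase hv] at this
    · have : m = v := by
        by_contra h
        exact hmT (Finset.mem_erase.mpr ⟨h, hm⟩)
      subst this
      exact (Finset.card_le_card (Finset.filter_subset_filter _ hsub)).trans hv1
  · have bound : ∀ v ∈ S, ∀ w ∈ S, G.Adj v w → (S.filter (G.Adj v)).card ≤ 2 →
        (S.filter (G.Adj w)).card ≤ 2 → (S.filter (G.SquareAdjIn S v)).card ≤ 5 := by
      intro v hv w hw hvw hv2 hw2
      have hwv : w ∈ S.filter (G.Adj v) := Finset.mem_filter.mpr ⟨hw, hvw⟩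
      refine (card_squareAdjIn_le S hv).trans ?_
      rw [← Finset.add_sum_erase _ _ hwv]
      have h1 : ∑ m ∈ (S.filter (G.Adj v)).erase w, (S.filter (G.Adj m)).card ≤ 1 * 3 := by
        refine (Finset.sum_le_card_nsmul _ _ 3 fun m _ => hdeg S m).trans ?_
        rw [smul_eq_mul, Finset.card_erase_of_mem hwv]
        exact Nat.mul_le_mul_right _ (by omega)
      omega
    have hsub : (S.erase v).erase w ⊆ S := (Finset.erase_subset _ _).trans (Finset.erase_subset _ _)
    have hwS : w ∈ S.erase v := Finset.mem_erase.mpr ⟨hvw.ne', hw⟩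
    obtain ⟨c, hc⟩ := ih ((S.erase v).erase w)
      ((Finset.erase_ssubset hwS).trans (Finset.erase_ssubset hv))
    have leaf : ∀ m n, n ∈ S → G.Adj m n → n ∉ (S.erase v).erase w →
        (S.filter (G.Adj m)).card ≤ 2 → (((S.erase v).erase w).filter (G.Adj m)).card ≤ 1 := by
      intro m n hn hmn hnT hm2
      have : ((S.erase v).erase w).filter (G.Adj m) ⊂ S.filter (G.Adj m) :=
        Finset.ssubset_iff_subset_ne.mpr ⟨Finset.filter_subset_filter _ hsub, fun h => hnT
          (Finset.mem_filter.mp (h ▸ Finset.mem_filter.mpr ⟨hn, hmn⟩ :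
            n ∈ ((S.erase v).erase w).filter (G.Adj m))).1⟩
      have := Finset.card_lt_card this
      omega
    obtain ⟨c₁, hc₁⟩ := hH.exists_extend (v := w) (R := G.SquareAdjIn S)
      (fun _ _ => SquareAdjIn.symm) (fun _ h => h.1 rfl)
      (by
        have := hL w
        have := hmono (v := w) hsub
        have := bound w hw v hv hvw.symm hw2 hv2
        omega)
      (fun x hx y hy hxy => hc x hx y hy (squareAdjIn_of_subset (fun m hm hmT => by
        by_cases hmv : m = v
        · subst hmv
          exact leaf m w hw hvw (Finset.notMem_erase _ _) hv2
        · have hmw : m = w := by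
            by_contra h
            exact hmT (Finset.mem_erase.mpr ⟨h, Finset.mem_erase.mpr ⟨hmv, hm⟩⟩)
          subst hmw
          exact leaf m v hv hvw.symm (fun h => Finset.notMem_erase v S (Finset.mem_erase.mp h).2)
            hw2) hx hy hxy))
    rw [Finset.insert_erase hwS] at hc₁
    have := hH.exists_extend (v := v) (R := G.SquareAdjIn S) (fun _ _ => SquareAdjIn.symm)
      (fun _ h => h.1 rfl)
      (by
        have := hL v
        have := hmono (v := v) (Finset.erase_subset v S)
        have := bound v hv w hw hvw hv2 hw2
        omega) hc₁
    rwa [Finset.insert_erase hv] at this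

lemma squareAdjIn_univ_of_square_adj [Fintype V] {x y : V} (h : G.square.Adj x y) :
    G.SquareAdjIn Finset.univ x y := by
  refine ⟨h.ne, ?_⟩
  rcases h with h | h
  · exact Or.inl h
  · right
    have hr : G.Reachable x y := by
      by_contra hr
      rw [dist_eq_zero_of_not_reachable hr] at h
      omega
    obtain ⟨p, hp⟩ := hr.exists_walk_length_eq_dist
    rw [h] at hp
    match p, hp with
    | .cons h1 (.cons h2 .nil), _ => exact ⟨_, Finset.mem_univ _, h1, h2⟩

end Coloring

end SimpleGraph

theorem mainTheorem4 {V : Type*} [Fintype V] (G : SimpleGraph V) [DecidableRel G.Adj]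
    (hplanar : G.IsPlanar) (hsubcubic : G.maxDegree ≤ 3) (hgirth : 12 < G.egirth) :
    G.square.dpChromaticNumber ≤ 6 := by
  classical
  refine iInf₂_le (6 : ℕ) (fun C L hL H hH => ?_)
  have hdeg : ∀ (S : Finset V) (v : V), (S.filter (G.Adj v)).card ≤ 3 := fun S v => by
    refine (Finset.card_le_card fun w hw => ?_).trans ((G.degree_le_maxDegree v).trans hsubcubic)
    exact (SimpleGraph.mem_neighborFinset ..).mpr (Finset.mem_filter.mp hw).2
  obtain ⟨c, hc⟩ := hH.exists_partial_coloring (G := G) hL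
    (fun S v => by convert hdeg S v) (fun S hS => by
      have : Nonempty (S : Set V) := hS.to_subtype
      have h := SimpleGraph.exists_degree_le_one_or_adj_degree_le_two (hplanar.induce (S : Set V))
        (fun v => (SimpleGraph.degree_induce_eq_card_filter S v).trans_le (hdeg S v))
        (hgirth.trans_le (SimpleGraph.egirth_le_egirth_induce _))
      simp only [SimpleGraph.degree_induce_eq_card_filter] at h
      rcases h with ⟨v, hv⟩ | ⟨v, w, hvw, hv, hw⟩
      · exact Or.inl ⟨v, v.2, by convert hv⟩
      · exact Or.inr ⟨v, v.2, w, w.2, hvw, by convert hv, by convert hw⟩) Finset.univ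
  refine ⟨Finset.univ.map ⟨fun v => ⟨v, c v⟩, fun v w h => congrArg Sigma.fst h⟩, ?_, ?_⟩
  · rintro x hx y hy hxy hadj
    simp only [Finset.coe_map, Finset.coe_univ, Set.image_univ, Set.mem_range] at hx hy
    obtain ⟨v, rfl⟩ := hx
    obtain ⟨w, rfl⟩ := hy
    have hvw : v ≠ w := fun h => hxy (by rw [h])
    by_cases hsq : G.square.Adj v w
    · exact hc v (Finset.mem_univ _) w (Finset.mem_univ _) 
        (SimpleGraph.squareAdjIn_univ_of_square_adj hsq) hadj
    · exact hH.not_adj v w hvw hsq _ _ hadj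
  · rw [Finset.card_map, Finset.card_univ, Nat.card_eq_fintype_card]
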